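/- All rings are commutative with unit. A ringed finite space is a ringed space $(X,\mathcal O)$ whose underlying topological space is finite. For $p,q\in X$ write $p\le q$ if $p\in\overline{\{q\}}$, let $U_p=\{x\in X: p\le x\}$ be the smallest open set containing $p$ and, for $p\le q$, let $r_{pq}\colon \mathcal O_p\to\mathcal O_q$ be the restriction morphism between the stalks. A point $p$ is a down beat point if $\overline{\{p\}}\setminus\{p\}$ has a maximum, and an up beat point if $U_p\setminus\{p\}$ has a minimum $q$ and $r_{pq}$ is an isomorphism. A ringed finite space is called minimal if it is $T_0$ and has neither down beat points nor up beat points. Let $I=[0,1]$. For a ringed space $(X,\mathcal O_X)$, let $X\times I$ be the product topological space with the sheaf of rings $\pi^{-1}\mathcal O_X$, where $\pi\colon X\times I\to X$ is the projection; for $t\in I$ let $i_t\colon X\to X\times I$ be the morphism of ringed spaces given by $x\mapsto (x,t)$ and the identity $i_t^{-1}\pi^{-1}\mathcal O_X=\mathcal O_X\to\mathcal O_X$. Two morphisms of ringed spaces $f,g\colon X\to Y$ are homotopic if there is a morphism of ringed spaces $H\colon X\times I\to Y$ with $H\circ i_0=f$ and $H\circ i_1=g$. \textbf{Theorem.} Let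 $X$ be a minimal ringed finite space and let $f\colon X\to X$ be a morphism of ringed spaces. Then $f$ is homotopic to the identity if and only if $f=\mathrm{Id}_X$ (as morphisms of ringed spaces). -/

import Mathlib

universe u

open CategoryTheory TopologicalSpace Opposite

namespace RingedFinite

open AlgebraicGeometry

noncomputable section

/-! ### The cylinder of a ringed space and homotopies of morphisms -/

/-- The projection `X × I → X`, where `I = [0, 1]` is the unit interval. -/
def cylProj (X : RingedSpace.{u, u}) : TopCat.of (X × unitInterval) ⟶ X.carrier :=
  TopCat.ofHom ⟨Prod.fst, continuous_fst⟩

/-- The continuous map `X → X × I`, `x ↦ (x, t)`. -/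
def cylInclBase (X : RingedSpace.{u, u}) (t : unitInterval) :
    X.carrier ⟶ TopCat.of (X × unitInterval) :=
  TopCat.ofHom ⟨fun x => (x, t), by fun_prop⟩

/-- The sheaf of rings on `X × I`: the inverse image `π⁻¹ O_X` under the projection `π`. -/
def cylSheaf (X : RingedSpace.{u, u}) :
    TopCat.Sheaf CommRingCat.{u} (TopCat.of (X × unitInterval)) :=
  (TopCat.Sheaf.pullback CommRingCat.{u} (cylProj X)).obj X.sheaf

/-- The ringed space `X × I`. -/
def cylinder (X : RingedSpace.{u, u}) : RingedSpace.{u, u} where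
  carrier := TopCat.of (X × unitInterval)
  presheaf := (cylSheaf X).1
  IsSheaf := (cylSheaf X).2

/-- The identity of `O_X`, seen as a morphism `O_X ⟶ π_* (i_t)_* O_X` (as `π ∘ i_t = id`). -/
def cylUnitMap (X : RingedSpace.{u, u}) (t : unitInterval) :
    X.sheaf ⟶ (TopCat.Sheaf.pushforward CommRingCat.{u} (cylProj X)).obj
      ((TopCat.Sheaf.pushforward CommRingCat.{u} (cylInclBase X t)).obj X.sheaf) where
  hom :=
    { app := fun U => 𝟙 (X.presheaf.obj U)
      naturality := fun _ _ i =>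
        (Category.comp_id (X.presheaf.map i)).trans (Category.id_comp (X.presheaf.map i)).symm }

/-- The morphism `π⁻¹ O_X ⟶ (i_t)_* O_X` which corresponds to the identity of
`i_t⁻¹ π⁻¹ O_X = O_X`, i.e. the adjunct of `cylUnitMap`. -/
def cylInclSheafMap (X : RingedSpace.{u, u}) (t : unitInterval) :
    cylSheaf X ⟶ (TopCat.Sheaf.pushforward CommRingCat.{u} (cylInclBase X t)).obj X.sheaf :=
  ((TopCat.Sheaf.pullbackPushforwardAdjunction CommRingCat.{u} (cylProj X)).homEquiv _ _).symm
    (cylUnitMap X t)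

/-- The morphism of ringed spaces `i_t : X ⟶ X × I`. -/
def cylIncl (X : RingedSpace.{u, u}) (t : unitInterval) : X ⟶ cylinder X :=
  InducedCategory.homMk
    { base := cylInclBase X t
      c := (cylInclSheafMap X t).1 }

/-- Two morphisms of ringed spaces `f g : X ⟶ Y` are homotopic if there is a morphism of ringed
spaces `H : X × I ⟶ Y` with `H ∘ i_0 = f` and `H ∘ i_1 = g`. -/
def Homotopic {X Y : RingedSpace.{u, u}} (f g : X ⟶ Y) : Prop :=
  ∃ H : cylinder X ⟶ Y, cylIncl X 0 ≫ H = f ∧ cylIncl X 1 ≫ H = g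

/-! ### Beat points and minimal ringed finite spaces

The preorder of a finite space is `p ≤ q ↔ p ∈ closure {q}`; in Mathlib's notation, `q ⤳ p`.
So `closure {p} = {x | x ≤ p}`, and the smallest open set containing `p` is
`U_p = nhdsKer {p} = {x | p ≤ x}`.  The restriction map `O_p → O_q` for `p ≤ q` is the
specialization map on stalks. -/

/-- `p` is a down beat point: `closure {p} \ {p}` has a maximum. -/
def IsDownBeatPoint (X : RingedSpace.{u, u}) (p : X) : Prop :=
  ∃ q ∈ closure {p} \ {p}, ∀ x ∈ closure {p} \ {p}, q ⤳ x

/-- `p` is an up beat point: `U_p \ {p}` has a minimum `q` and the restriction map `O_p → O_q` is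
an isomorphism. -/
def IsUpBeatPoint (X : RingedSpace.{u, u}) (p : X) : Prop :=
  ∃ q ∈ nhdsKer {p} \ {p}, (∀ x ∈ nhdsKer {p} \ {p}, x ⤳ q) ∧
    ∃ h : q ⤳ p, IsIso (X.presheaf.stalkSpecializes h)

/-- A minimal ringed finite space: a ringed space whose underlying space is finite and `T₀`, without
down beat points and up beat points. -/
structure IsMinimal (X : RingedSpace.{u, u}) : Prop where
  finite : Finite X
  t0 : T0Space X
  not_down : ∀ p : X, ¬ IsDownBeatPoint X p
  not_up : ∀ p : X, ¬ IsUpBeatPoint X p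

end

end RingedFinite

namespace RingedFinite

open AlgebraicGeometry

/-! Let `f_t = H ∘ i_t`. By finiteness, every `t` near `t₀` satisfies `f_{t₀} ≤ f_t` pointwise, and
sections of `π⁻¹O_X` are locally constant in `t`, so the stalk maps of `f_{t₀}` factor through those
of `f_t` (`eventually_refines`). On a minimal space the identity is isolated for this relation in
both directions (`IsMinimal.eq_id_of_id_refines`, `IsMinimal.eq_id_of_refines_id`). Hence `{t | f_t
= id}` is open and closed in `I`, and it contains `1`. -/

/-! ### Germs of the inverse image sheaf. -/

/-- The canonical morphism from the presheaf pullback to the sheaf pullback. -/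
noncomputable def presheafPullbackToPullback {X Y : TopCat.{u}} (f : X ⟶ Y)
    (F : TopCat.Sheaf CommRingCat.{u} Y) :
    (TopCat.Presheaf.pullback CommRingCat.{u} f).obj F.1 ⟶
      ((TopCat.Sheaf.pullback CommRingCat.{u} f).obj F).1 :=
  toSheafify (Opens.grothendieckTopology X) _ ≫
    ((TopCat.Sheaf.pullbackIso CommRingCat.{u} f).inv.app F).1

/-- Both sides are units of adjunctions with the same right adjoint, matched by uniqueness of left
adjoints. -/
lemma unit_presheafPullbackToPullback {X Y : TopCat.{u}} (f : X ⟶ Y)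
    (F : TopCat.Sheaf CommRingCat.{u} Y) :
    (TopCat.Presheaf.pullbackPushforwardAdjunction CommRingCat.{u} f).unit.app F.1 ≫
      (TopCat.Presheaf.pushforward CommRingCat.{u} f).map (presheafPullbackToPullback f F) =
    ((TopCat.Sheaf.pullbackPushforwardAdjunction CommRingCat.{u} f).unit.app F).1 := by
  have h1 := Adjunction.unit_leftAdjointUniq_hom_app
    (Functor.sheafPullbackConstruction.sheafAdjunctionContinuous (Opens.map f) CommRingCat.{u}
      (Opens.grothendieckTopology Y) (Opens.grothendieckTopology X))
    (TopCat.Sheaf.pullbackPushforwardAdjunction CommRingCat.{u} f) F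
  rw [← h1]
  have h2 := Adjunction.map_restrictFullyFaithful_unit_app
    (((Opens.map f).op.lanAdjunction CommRingCat.{u}).comp
      (sheafificationAdjunction (Opens.grothendieckTopology X) CommRingCat.{u}))
    (fullyFaithfulSheafToPresheaf (Opens.grothendieckTopology Y) CommRingCat.{u})
    (Functor.FullyFaithful.id _)
    (L := Functor.sheafPullbackConstruction.sheafPullback (Opens.map f) CommRingCat.{u}
      (Opens.grothendieckTopology Y) (Opens.grothendieckTopology X))
    (R := (Opens.map f).sheafPushforwardContinuous CommRingCat.{u}
      (Opens.grothendieckTopology Y) (Opens.grothendieckTopology X))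
    (Iso.refl _) (Iso.refl _) F
  have h3 : ((Functor.sheafPullbackConstruction.sheafAdjunctionContinuous (Opens.map f)
      CommRingCat.{u} (Opens.grothendieckTopology Y) (Opens.grothendieckTopology X)).unit.app F).1 =
      ((Opens.map f).op.lanAdjunction CommRingCat.{u}).unit.app F.1 ≫
        Functor.whiskerLeft (Opens.map f).op (toSheafify (Opens.grothendieckTopology X)
          ((TopCat.Presheaf.pullback CommRingCat.{u} f).obj F.1)) := by
    refine h2.trans ?_
    simp only [Adjunction.comp_unit_app, Category.assoc]
    rfl
  refine Eq.trans ?_ (congr($h3 ≫ Functor.whiskerLeft (Opens.map f).op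
    ((TopCat.Sheaf.pullbackIso CommRingCat.{u} f).inv.app F).1)).symm
  rfl

lemma isLocallySurjective_presheafPullbackToPullback {X Y : TopCat.{u}} (f : X ⟶ Y)
    (F : TopCat.Sheaf CommRingCat.{u} Y) :
    TopCat.Presheaf.IsLocallySurjective (presheafPullbackToPullback f F) := by
  let e := TopCat.Sheaf.pullbackIso CommRingCat.{u} f
  let g : sheafify (Opens.grothendieckTopology X)
      ((TopCat.Presheaf.pullback CommRingCat.{u} f).obj F.1) ⟶
      ((TopCat.Sheaf.pullback CommRingCat.{u} f).obj F).1 := (e.inv.app F).1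
  have : IsIso g :=
    ⟨(e.hom.app F).1, congr(($(e.inv_hom_id_app F)).1), congr(($(e.hom_inv_id_app F)).1)⟩
  exact Presheaf.isLocallySurjective_comp (Opens.grothendieckTopology X)
    (toSheafify (Opens.grothendieckTopology X)
      ((TopCat.Presheaf.pullback CommRingCat.{u} f).obj F.1)) g

/-- The presheaf pullback has stalk `F_{f x}` at `x`, and sheafification is surjective on stalks. -/
lemma exists_germ_pullback_eq {X Y : TopCat.{u}} (f : X ⟶ Y)
    (F : TopCat.Sheaf CommRingCat.{u} Y) (x : X)
    (τ : ((TopCat.Sheaf.pullback CommRingCat.{u} f).obj F).presheaf.stalk x) :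
    ∃ (U : Opens Y) (hU : f x ∈ U) (s : F.1.obj (op U)),
      TopCat.Presheaf.germ ((TopCat.Sheaf.pullback CommRingCat.{u} f).obj F).1
          ((Opens.map f).obj U) x hU
        (((TopCat.Sheaf.pullbackPushforwardAdjunction CommRingCat.{u} f).unit.app F).1.app (op U) s)
        = τ := by
  obtain ⟨ρ, rfl⟩ := (TopCat.Presheaf.locally_surjective_iff_surjective_on_stalks _).1
    (isLocallySurjective_presheafPullbackToPullback f F) x τ
  obtain ⟨y, rfl⟩ : ∃ y, TopCat.Presheaf.stalkPullbackHom CommRingCat.{u} f F.1 x y = ρ :=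
    ⟨(TopCat.Presheaf.stalkPullbackIso CommRingCat.{u} f F.1 x).inv ρ, by
      have := (TopCat.Presheaf.stalkPullbackIso CommRingCat.{u} f F.1 x).inv_hom_id
      exact congr($this ρ)⟩
  obtain ⟨U, hU, s, rfl⟩ := TopCat.Presheaf.exists_germ_eq F.1 y
  refine ⟨U, hU, s, ?_⟩
  rw [← unit_presheafPullbackToPullback]
  have := TopCat.Presheaf.germ_stalkPullbackHom CommRingCat.{u} f F.1 x U hU
  have := congr($this s)
  simp only [CommRingCat.comp_apply] at this
  rw [this]
  erw [TopCat.Presheaf.stalkFunctor_map_germ_apply]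
  rfl

/-! ### Rigidity of minimal spaces. -/

/-- `Refines f g`: pointwise `f x ≤ g x`, and the stalk maps of `f` factor through those of `g`
via the restriction maps. -/
def Refines {X Y : RingedSpace.{u, u}} (f g : X ⟶ Y) : Prop :=
  ∀ x : X, ∃ h : g.hom.base x ⤳ f.hom.base x,
    Y.presheaf.stalkSpecializes h ≫ g.hom.stalkMap x = f.hom.stalkMap x

lemma Refines.eq_of_base_eq {X Y : RingedSpace.{u, u}} {f g : X ⟶ Y} (h : Refines f g)
    (hb : f.hom.base = g.hom.base) : f = g := by
  obtain ⟨⟨fb, fc⟩⟩ := f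
  obtain ⟨⟨gb, gc⟩⟩ := g
  obtain rfl : fb = gb := hb
  have : fc = gc := by
    ext U s
    refine TopCat.Presheaf.section_ext X.sheaf _ _ _ fun x hx => ?_
    obtain ⟨h₁, h₂⟩ := h x
    have e₁ := PresheafedSpace.stalkMap_germ_apply (X := X.toPresheafedSpace)
      (Y := Y.toPresheafedSpace) ⟨fb, fc⟩ U x hx s
    have e₂ := PresheafedSpace.stalkMap_germ_apply (X := X.toPresheafedSpace)
      (Y := Y.toPresheafedSpace) ⟨fb, gc⟩ U x hx s
    refine e₁.symm.trans (Eq.trans ?_ e₂)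
    simp only [TopCat.Presheaf.stalkSpecializes_refl, Category.id_comp] at h₂
    exact congr($(h₂.symm) _)
  subst this
  rfl

lemma IsMinimal.eq_id_of_id_refines {X : RingedSpace.{u, u}} (hX : IsMinimal X) {g : X ⟶ X}
    (h : Refines (𝟙 X) g) : g = 𝟙 X := by
  have := hX.finite
  have := hX.t0
  let r : X → X → Prop := fun a b => a ⤳ b ∧ a ≠ b
  have : IsTrans X r := ⟨fun a b c hab hbc => ⟨hab.1.trans hbc.1, fun e => by
    subst e; exact hab.2 (hab.1.antisymm hbc.1).eq⟩⟩
  have : Std.Irrefl r := ⟨fun a ha => ha.2 rfl⟩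
  have hr : WellFounded r := Finite.wellFounded_of_trans_of_irrefl r
  -- Induction from the maximal points down: if `g` fixes all points above `x` but moves `x`, then
  -- `g x` is the minimum of `U_x \ {x}`.
  refine (h.eq_of_base_eq ?_).symm
  ext x
  refine (hr.induction (C := fun x => g.hom.base x = x) x fun x ih => ?_).symm
  by_contra hx
  obtain ⟨h₁, h₂⟩ := h x
  refine hX.not_up x ⟨g.hom.base x, ⟨mem_nhdsKer_singleton.2 h₁, hx⟩, fun z hz => ?_, h₁, ?_⟩
  · have hz₁ : z ⤳ x := mem_nhdsKer_singleton.1 hz.1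
    have := hz₁.map g.hom.base.hom.continuous
    rwa [← ih z ⟨hz₁, hz.2⟩]
  · obtain ⟨h₃, h₄⟩ := h (g.hom.base x)
    -- The stalk map of `g` at `x` inverts the restriction: one composite is the hypothesis at `x`,
    -- the other, by naturality, the hypothesis at `g x`.
    refine ⟨g.hom.stalkMap x, h₂.trans (PresheafedSpace.stalkMap.id _ x), ?_⟩
    exact (PresheafedSpace.stalkMap.stalkSpecializes_stalkMap g.hom h₁).symm.trans
      (h₄.trans (PresheafedSpace.stalkMap.id _ _))

lemma IsMinimal.eq_id_of_refines_id {X : RingedSpace.{u, u}} (hX : IsMinimal X) {g : X ⟶ X}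
    (h : Refines g (𝟙 X)) : g = 𝟙 X := by
  have := hX.finite
  have := hX.t0
  let r : X → X → Prop := fun a b => b ⤳ a ∧ a ≠ b
  have : IsTrans X r := ⟨fun a b c hab hbc => ⟨hbc.1.trans hab.1, fun e => by
    subst e; exact hab.2 (hbc.1.antisymm hab.1).eq⟩⟩
  have : Std.Irrefl r := ⟨fun a ha => ha.2 rfl⟩
  have hr : WellFounded r := Finite.wellFounded_of_trans_of_irrefl r
  refine h.eq_of_base_eq ?_
  ext x
  refine hr.induction (C := fun x => g.hom.base x = x) x fun x ih => ?_
  by_contra hx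
  obtain ⟨h₁, -⟩ := h x
  refine hX.not_down x ⟨g.hom.base x, ⟨specializes_iff_mem_closure.1 h₁, hx⟩, fun z hz => ?_⟩
  have hz₁ : x ⤳ z := specializes_iff_mem_closure.2 hz.1
  have := hz₁.map g.hom.base.hom.continuous
  rwa [← ih z ⟨hz₁, hz.2⟩]

/-! ### Cylinders and nearby slices of a homotopy. -/

/-- The unit `O_X ⟶ π_* π⁻¹ O_X`. -/
noncomputable def cylUnit (X : RingedSpace.{u, u}) :
    X.sheaf ⟶ (TopCat.Sheaf.pushforward CommRingCat.{u} (cylProj X)).obj (cylSheaf X) :=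
  (TopCat.Sheaf.pullbackPushforwardAdjunction CommRingCat.{u} (cylProj X)).unit.app X.sheaf

lemma cylUnit_comp_cylInclSheafMap (X : RingedSpace.{u, u}) (t : unitInterval) :
    cylUnit X ≫ (TopCat.Sheaf.pushforward CommRingCat.{u} (cylProj X)).map (cylInclSheafMap X t) =
      cylUnitMap X t := by
  have := Adjunction.homEquiv_unit (TopCat.Sheaf.pullbackPushforwardAdjunction CommRingCat.{u} (cylProj X))
    (f := cylInclSheafMap X t)
  exact this.symm.trans (Equiv.apply_symm_apply _ _)

lemma cylInclSheafMap_cylUnit (X : RingedSpace.{u, u}) (t : unitInterval) (U : Opens X)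
    (s : X.presheaf.obj (op U)) :
    (cylInclSheafMap X t).1.app (op ((Opens.map (cylProj X)).obj U))
      ((cylUnit X).1.app (op U) s) = s := by
  have h := congr(($(cylUnit_comp_cylInclSheafMap X t)).1.app (op U))
  exact congr($h s)

/-- The projection `X × I ⟶ X` as a morphism of ringed spaces. -/
noncomputable def cylProjHom (X : RingedSpace.{u, u}) : cylinder X ⟶ X :=
  InducedCategory.homMk
    { base := cylProj X
      c := (cylUnit X).1 }

lemma cylIncl_comp_cylProjHom (X : RingedSpace.{u, u}) (t : unitInterval) :
    cylIncl X t ≫ cylProjHom X = 𝟙 X := by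
  refine SheafedSpace.ext _ _ rfl ?_
  ext U s
  refine Eq.trans ?_ (cylInclSheafMap_cylUnit X t U s)
  exact congr($(X.presheaf.map_id _) _)

/-- Near each `(x, a)` the section is pulled back from some `s` on `X`, and every `i_b` restricts
that pullback to `s`; so the germ is locally constant in `b`. -/
lemma germ_cylIncl_eq_of_isPreconnected (X : RingedSpace.{u, u}) (x : X)
    (W : Opens (cylinder X)) (σ : (cylinder X).presheaf.obj (op W)) {J : Set unitInterval}
    (hJ : _root_.IsPreconnected J) (hW : ∀ t ∈ J, (x, t) ∈ W) {t t' : unitInterval}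
    (ht : t ∈ J) (ht' : t' ∈ J) :
    X.presheaf.germ ((Opens.map (cylInclBase X t)).obj W) x (hW t ht)
        ((cylInclSheafMap X t).1.app (op W) σ) =
      X.presheaf.germ ((Opens.map (cylInclBase X t')).obj W) x (hW t' ht')
        ((cylInclSheafMap X t').1.app (op W) σ) := by
  have : PreconnectedSpace J := isPreconnected_iff_preconnectedSpace.1 hJ
  have hc : IsLocallyConstant (fun a : J =>
      X.presheaf.germ ((Opens.map (cylInclBase X a)).obj W) x (hW a a.2)
        ((cylInclSheafMap X a).1.app (op W) σ)) := by
    rw [IsLocallyConstant.iff_eventually_eq]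
    intro a
    obtain ⟨U, hU, s, hs⟩ := exists_germ_pullback_eq (cylProj X) X.sheaf (x, a.1)
      ((cylinder X).presheaf.germ W (x, a.1) (hW a a.2) σ)
    obtain ⟨V, hV, iU, iW, hVs⟩ := TopCat.Presheaf.germ_eq (cylSheaf X).1 (x, a.1) hU (hW a a.2) _ _ hs
    have key : ∀ b : J, (x, b.1) ∈ V →
        X.presheaf.germ ((Opens.map (cylInclBase X b)).obj W) x (hW b b.2)
        ((cylInclSheafMap X b).1.app (op W) σ) = X.presheaf.germ U x hU s := by
      intro b hb
      have e₁ := congr(X.presheaf.germ ((Opens.map (cylInclBase X b)).obj V) x hb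
        ((cylInclSheafMap X b).1.app (op V) $hVs))
      have n₁ := congr($((cylInclSheafMap X b).1.naturality iU.op)
        ((cylUnit X).1.app (op U) s))
      have n₂ := congr($((cylInclSheafMap X b).1.naturality iW.op) σ)
      have e₂ := e₁.symm
      refine Eq.trans ?_ (e₂.trans ?_)
      · refine Eq.trans ?_ congr(X.presheaf.germ ((Opens.map (cylInclBase X b)).obj V) x hb $n₂).symm
        exact (TopCat.Presheaf.germ_res_apply X.presheaf
          ((Opens.map (cylInclBase X b)).map iW) x hb _).symm
      · refine congr(X.presheaf.germ ((Opens.map (cylInclBase X b)).obj V) x hb $n₁).trans ?_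
        refine (TopCat.Presheaf.germ_res_apply X.presheaf
          ((Opens.map (cylInclBase X b)).map iU) x hb _).trans ?_
        exact congr(X.presheaf.germ U x hU $(cylInclSheafMap_cylUnit X b U s))
    have hmem : ∀ᶠ b : J in nhds a, (x, b.1) ∈ V :=
      (V.2.preimage (f := fun b : J => ((x, b.1) : X × unitInterval)) (by fun_prop)).mem_nhds hV
    filter_upwards [hmem] with b hb
    rw [key b hb, key a hV]
  exact hc.apply_eq_of_preconnectedSpace ⟨t, ht⟩ ⟨t', ht'⟩

lemma eventually_refines {X Y : RingedSpace.{u, u}} [Finite X] [Finite Y] (H : cylinder X ⟶ Y)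
    (t₀ : unitInterval) :
    ∀ᶠ t in nhds t₀, Refines (cylIncl X t₀ ≫ H) (cylIncl X t ≫ H) := by
  refine Filter.eventually_all.2 fun x => ?_
  let φ : X × unitInterval → Y := H.hom.base
  have hφ : Continuous φ := H.hom.base.hom.continuous
  have hO : IsOpen {t : unitInterval | φ (x, t) ∈ nhdsKer {φ (x, t₀)}} :=
    isOpen_nhdsKer.preimage (hφ.comp (by fun_prop))
  have hmem : t₀ ∈ {t : unitInterval | φ (x, t) ∈ nhdsKer {φ (x, t₀)}} :=
    mem_nhdsKer_singleton.2 specializes_rfl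
  -- A ball is taken because the germ comparison needs a connected set of parameters.
  obtain ⟨ε, hε, hJ⟩ := Metric.mem_nhds_iff.1 (hO.mem_nhds hmem)
  set J := Metric.ball t₀ ε
  have hJt : t₀ ∈ J := Metric.mem_ball_self hε
  have hJc : _root_.IsPreconnected J :=
    (((convex_ball (t₀ : ℝ) ε).ordConnected).preimage_mono
      (Subtype.mono_coe (· ∈ Set.Icc (0 : ℝ) 1))).isPreconnected
  filter_upwards [Metric.ball_mem_nhds t₀ hε] with t ht
  have hs : φ (x, t) ⤳ φ (x, t₀) := mem_nhdsKer_singleton.1 (hJ ht)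
  refine ⟨hs, ?_⟩
  refine TopCat.Presheaf.stalk_hom_ext _ fun U hU => ?_
  ext s
  have hJU : ∀ b ∈ J, (x, b) ∈ (Opens.map H.hom.base).obj U := fun b hb =>
    (mem_nhdsKer_singleton.1 (hJ hb)).mem_open U.2 hU
  have e₀ := PresheafedSpace.stalkMap_germ_apply (cylIncl X t₀ ≫ H).hom U x hU s
  have e₁ := PresheafedSpace.stalkMap_germ_apply (cylIncl X t ≫ H).hom U x (hJU t ht) s
  have e₂ := TopCat.Presheaf.germ_stalkSpecializes_apply Y.presheaf hU hs s
  refine Eq.trans ?_ e₀.symm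
  refine congr((cylIncl X t ≫ H).hom.stalkMap x $e₂).trans (e₁.trans ?_)
  exact germ_cylIncl_eq_of_isPreconnected X x ((Opens.map H.hom.base).obj U)
    (H.hom.c.app (op U) s) hJc hJU ht hJt

end RingedFinite


theorem mainTheorem7 (X : AlgebraicGeometry.RingedSpace.{u, u}) (hX : RingedFinite.IsMinimal X)
    (f : X ⟶ X) : RingedFinite.Homotopic f (𝟙 X) ↔ f = 𝟙 X := by
  open RingedFinite in
  constructor
  · rintro ⟨H, rfl, h₁⟩
    have := hX.finite
    have hS : IsClopen {t : unitInterval | cylIncl X t ≫ H = 𝟙 X} := by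
      refine ⟨isOpen_compl_iff.1 (isOpen_iff_eventually.2 fun t₀ ht₀ => ?_),
        isOpen_iff_eventually.2 fun t₀ ht₀ => ?_⟩
      -- Closedness: if `f_t = id` for such a `t` near `t₀`, then `f_{t₀}` refines `id`, so it
      -- equals `id`.
      · filter_upwards [eventually_refines H t₀] with t ht h
        rw [h.out] at ht
        exact ht₀ (hX.eq_id_of_refines_id ht)
      · filter_upwards [eventually_refines H t₀] with t ht
        rw [ht₀.out] at ht
        exact hX.eq_id_of_id_refines ht
    exact Set.eq_univ_iff_forall.1 (hS.eq_univ ⟨1, h₁⟩) 0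
  · rintro rfl
    exact ⟨cylProjHom X, cylIncl_comp_cylProjHom X 0, cylIncl_comp_cylProjHom X 1⟩
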